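/- Let $(M,P,g)$ be a Riemannian almost product manifold, i.e. a smooth manifold $M$ with a Riemannian metric $g$ and a smooth tensor field $P$ of type $(1,1)$ such that $P^2x=x$ and $g(Px,Py)=g(x,y)$ for all smooth vector fields $x,y$ on $M$. Let $\nabla$ be the Levi-Civita connection of $g$, and let $\nabla'$ be a natural connection on $(M,P,g)$, i.e. a linear connection with $\nabla'P=0$ and $\nabla'g=0$. Put $$Q(x,y)=\nabla'_xy-\nabla_xy,\qquad Q(x,y,z)=g(Q(x,y),z),\qquad T(x,y)=\nabla'_xy-\nabla'_yx-[x,y],$$ and let $$R(x,y,z,w)=g(\nabla_x\nabla_yz-\nabla_y\nabla_xz-\nabla_{[x,y]}z,\;w),\qquad R'(x,y,z,w)=g(\nabla'_x\nabla'_yz-\nabla'_y\nabla'_xz-\nabla'_{[x,y]}z,\;w)$$ be the curvature tensors of $\nabla$ and $\nabla'$. If $\nabla'$ has parallel torsion, $\nabla'T=0$, then for all smooth vector fields $x,y,z,w$ on $M$ $$R'(x,y,z,w)=R(x,y,z,w)+Q(T(x,y),z,w)+g(Q(y,z),Q(x,w))-g(Q(x,z),Q(y,w)).$$ -/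

import Mathlib

open Bundle Manifold
open scoped ContDiff

namespace AlmostProduct

noncomputable section

variable
  {E : Type*} [NormedAddCommGroup E] [NormedSpace ℝ E]
  {H : Type*} [TopologicalSpace H] {I : ModelWithCorners ℝ E H}
  {M : Type*} [TopologicalSpace M] [ChartedSpace H M] [IsManifold I ∞ M]

/-- `X` is a smooth vector field on `M`, i.e. an element of `𝔛(M)`. -/
def IsSmoothField (X : Π p : M, TangentSpace I p) : Prop :=
  ContMDiff I I.tangent ∞ (fun p ↦ (⟨p, X p⟩ : TangentBundle I M))

/-- The vector field `∇_X Y`. (Mathlib writes `∇_X Y` at `p` as `cov Y p (X p)`.) -/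
def nabla (cov : CovariantDerivative I E (TangentSpace I : M → Type _))
    (X Y : Π p : M, TangentSpace I p) : Π p : M, TangentSpace I p :=
  fun p ↦ cov Y p (X p)

/-- The curvature `R(X, Y) Z = ∇_X ∇_Y Z - ∇_Y ∇_X Z - ∇_{[X, Y]} Z` of a linear connection. -/
def curvature (cov : CovariantDerivative I E (TangentSpace I : M → Type _))
    (X Y Z : Π p : M, TangentSpace I p) : Π p : M, TangentSpace I p :=
  fun p ↦ nabla cov X (nabla cov Y Z) p - nabla cov Y (nabla cov X Z) p
    - nabla cov (VectorField.mlieBracket I X Y) Z p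

/-- The deformation tensor `Q(X, Y) = ∇'_X Y - ∇_X Y` of the transformation `∇ → ∇'`. -/
def deformation (cov cov' : CovariantDerivative I E (TangentSpace I : M → Type _))
    (X Y : Π p : M, TangentSpace I p) : Π p : M, TangentSpace I p :=
  fun p ↦ nabla cov' X Y p - nabla cov X Y p

section Torsion

variable [FiniteDimensional ℝ E] [CompleteSpace E]

/-- The torsion `T(X, Y) = ∇_X Y - ∇_Y X - [X, Y]`, evaluated on vector fields. -/
def torsionField (cov : CovariantDerivative I E (TangentSpace I : M → Type _))
    (X Y : Π p : M, TangentSpace I p) : Π p : M, TangentSpace I p :=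
  fun p ↦ cov.torsion p (X p) (Y p)

/-- `(∇_X T)(Y, Z) = ∇_X (T(Y, Z)) - T(∇_X Y, Z) - T(Y, ∇_X Z)`, the covariant derivative of the
torsion tensor `T` of `∇` with respect to `∇` itself. -/
def derivTorsion (cov : CovariantDerivative I E (TangentSpace I : M → Type _))
    (X Y Z : Π p : M, TangentSpace I p) : Π p : M, TangentSpace I p :=
  fun p ↦ nabla cov X (torsionField cov Y Z) p - torsionField cov (nabla cov X Y) Z p
    - torsionField cov Y (nabla cov X Z) p

/-- The connection has parallel torsion: `∇ T = 0`. -/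
def HasParallelTorsion (cov : CovariantDerivative I E (TangentSpace I : M → Type _)) : Prop :=
  ∀ X Y Z : Π p : M, TangentSpace I p, IsSmoothField X → IsSmoothField Y → IsSmoothField Z →
    derivTorsion cov X Y Z = 0

end Torsion

/-- `(∇_X P) Y = ∇_X (P Y) - P (∇_X Y)` for a tensor field `P` of type `(1,1)`. -/
def derivEndo (cov : CovariantDerivative I E (TangentSpace I : M → Type _))
    (P : Π p : M, TangentSpace I p →L[ℝ] TangentSpace I p)
    (X Y : Π p : M, TangentSpace I p) : Π p : M, TangentSpace I p :=
  fun p ↦ nabla cov X (fun q ↦ P q (Y q)) p - P p (nabla cov X Y p)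

section Metric

variable [RiemannianBundle (fun p : M ↦ TangentSpace I p)]

/-- `(M, P, g)` is a Riemannian almost product manifold, where `g` is the Riemannian metric given
by the `RiemannianBundle` structure on the tangent bundle: `P` is a smooth tensor field of type
`(1,1)` with `P² = id` and `g(P v, P w) = g(v, w)`. -/
structure IsAlmostProductStructure
    (P : Π p : M, TangentSpace I p →L[ℝ] TangentSpace I p) : Prop where
  smooth : ContMDiff I (I.prod 𝓘(ℝ, E →L[ℝ] E)) ∞
    (fun p ↦ TotalSpace.mk' (E →L[ℝ] E)
      (E := fun p : M ↦ TangentSpace I p →L[ℝ] TangentSpace I p) p (P p))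
  involutive : ∀ (p : M) (v : TangentSpace I p), P p (P p v) = v
  isometry : ∀ (p : M) (v w : TangentSpace I p), inner ℝ (P p v) (P p w) = inner ℝ v w

/-- `∇ g = 0`, i.e. `X g(Y, Z) = g(∇_X Y, Z) + g(Y, ∇_X Z)`. -/
def IsMetric (cov : CovariantDerivative I E (TangentSpace I : M → Type _)) : Prop :=
  ∀ X Y Z : Π p : M, TangentSpace I p, IsSmoothField X → IsSmoothField Y → IsSmoothField Z →
    ∀ p : M, mvfderiv I (fun q ↦ (inner ℝ (Y q) (Z q) : ℝ)) p (X p)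
      = inner ℝ (nabla cov X Y p) (Z p) + inner ℝ (Y p) (nabla cov X Z p)

/-- `∇` is the Levi-Civita connection of the metric: `∇ g = 0` and `∇` is torsion-free. -/
structure IsLeviCivita [FiniteDimensional ℝ E] [CompleteSpace E]
    (cov : CovariantDerivative I E (TangentSpace I : M → Type _)) : Prop where
  metric : IsMetric cov
  torsion_free : cov.torsion = 0

/-- `∇'` is a natural connection on `(M, P, g)`: `∇' P = 0` and `∇' g = 0`. -/
structure IsNaturalConnection (P : Π p : M, TangentSpace I p →L[ℝ] TangentSpace I p)
    (cov' : CovariantDerivative I E (TangentSpace I : M → Type _)) : Prop where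
  parallel : ∀ X Y : Π p : M, TangentSpace I p, IsSmoothField X → IsSmoothField Y →
    derivEndo cov' P X Y = 0
  metric : IsMetric cov'

end Metric

end

end AlmostProduct

namespace AlmostProduct

section DeformationCalculus

variable
  {E : Type*} [NormedAddCommGroup E] [NormedSpace ℝ E]
  {H : Type*} [TopologicalSpace H] {I : ModelWithCorners ℝ E H}
  {M : Type*} [TopologicalSpace M] [ChartedSpace H M] [IsManifold I ∞ M]

/-! Substituting ∇ = ∇' - Q into the curvature of ∇ gives, in `curvature_eq`, R'(x,y)z = R(x,y)z +
Q(T(x,y),z) + (∇'_x Q)(y,z) - (∇'_y Q)(x,z) - Q(x,Q(y,z)) + Q(y,Q(x,z)). Since both connections are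
metric, Q is skew in its last two arguments, so a Koszul-type formula expresses Q through T and g
alone (`two_mul_inner_deformation`). As T and g are ∇'-parallel, so is Q
(`inner_nabla_deformation`), and the derivative terms vanish. Skewness then turns the quadratic
terms into the stated inner products. -/

lemma IsSmoothField.mdifferentiableAt {X : Π p : M, TangentSpace I p} (hX : IsSmoothField X)
    (p : M) : MDifferentiableAt I I.tangent (fun q ↦ (⟨q, X q⟩ : TangentBundle I M)) p :=
  ContMDiffAt.mdifferentiableAt (hX p) (by simp)

lemma IsSmoothField.sub {X Y : Π p : M, TangentSpace I p} (hX : IsSmoothField X)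
    (hY : IsSmoothField Y) : IsSmoothField (fun p ↦ X p - Y p) :=
  ContMDiff.sub_section hX hY

/-- A smooth connection sends `Y` to a smooth section of Hom(TM, TM), which is then contracted with
`X`. -/
lemma IsSmoothField.nabla {D : CovariantDerivative I E (TangentSpace I : M → Type _)}
    [h : CovariantDerivative.ContMDiffCovariantDerivative D ∞]
    {X Y : Π p : M, TangentSpace I p} (hX : IsSmoothField X) (hY : IsSmoothField Y) :
    IsSmoothField (AlmostProduct.nabla D X Y) := by
  have h1 := (h.contMDiff.contMDiff (σ := Y) (ContMDiff.contMDiffOn hY))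
  intro p
  have h2 := (contMDiffOn_univ.1 h1) p
  exact ContMDiffAt.clm_bundle_apply h2 (hX p)

lemma IsSmoothField.deformation {D D' : CovariantDerivative I E (TangentSpace I : M → Type _)}
    [CovariantDerivative.ContMDiffCovariantDerivative D ∞]
    [CovariantDerivative.ContMDiffCovariantDerivative D' ∞]
    {X Y : Π p : M, TangentSpace I p} (hX : IsSmoothField X) (hY : IsSmoothField Y) :
    IsSmoothField (AlmostProduct.deformation D D' X Y) :=
  (hX.nabla (D := D') hY).sub (hX.nabla (D := D) hY)

/-- A linear connection is compatible with subtraction of smooth vector fields. -/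
lemma nabla_sub (D : CovariantDerivative I E (TangentSpace I : M → Type _))
    (X : Π p : M, TangentSpace I p) {Y Z : Π p : M, TangentSpace I p}
    (hY : IsSmoothField Y) (hZ : IsSmoothField Z) (p : M) :
    nabla D X (fun q ↦ Y q - Z q) p = nabla D X Y p - nabla D X Z p := by
  -- Additivity is applied to the splitting Y = (Y - Z) + Z.
  have h := (D.isCovariantDerivativeOn (s := Set.univ)).add
    ((hY.sub hZ).mdifferentiableAt p) (hZ.mdifferentiableAt p)
  have e : ((fun q ↦ Y q - Z q) + Z : Π p : M, TangentSpace I p) = Y := by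
    funext q; simp
  rw [e] at h
  simp only [nabla, h]
  simp

/-- The connection `∇` is recovered as `∇' - Q`. -/
lemma nabla_eq_sub_deformation (D D' : CovariantDerivative I E (TangentSpace I : M → Type _))
    (X Y : Π p : M, TangentSpace I p) :
    nabla D X Y = fun p ↦ nabla D' X Y p - deformation D D' X Y p := by
  funext p; simp [deformation]

/-- The deformation tensor depends linearly on the value of its first argument. -/
lemma deformation_sub_sub (D D' : CovariantDerivative I E (TangentSpace I : M → Type _))
    {X Y₁ Y₂ Y₃ : Π p : M, TangentSpace I p} (Z : Π p : M, TangentSpace I p) {p : M}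
    (h : X p = Y₁ p - Y₂ p - Y₃ p) :
    deformation D D' X Z p
      = deformation D D' Y₁ Z p - deformation D D' Y₂ Z p - deformation D D' Y₃ Z p := by
  simp only [deformation, nabla, h, map_sub]
  abel

/-- Second covariant derivatives of `∇ = ∇' - Q` in terms of `∇'` and `Q`. -/
lemma nabla_nabla_eq {D D' : CovariantDerivative I E (TangentSpace I : M → Type _)}
    [CovariantDerivative.ContMDiffCovariantDerivative D ∞]
    [CovariantDerivative.ContMDiffCovariantDerivative D' ∞]
    (X : Π p : M, TangentSpace I p) {Y Z : Π p : M, TangentSpace I p} (hY : IsSmoothField Y)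
    (hZ : IsSmoothField Z) (p : M) :
    nabla D X (nabla D Y Z) p = nabla D' X (nabla D' Y Z) p
      - nabla D' X (deformation D D' Y Z) p - deformation D D' X (nabla D' Y Z) p
      + deformation D D' X (deformation D D' Y Z) p := by
  have hQ : IsSmoothField (deformation D D' Y Z) := hY.deformation hZ
  have hN : IsSmoothField (nabla D' Y Z) := hY.nabla hZ
  rw [nabla_eq_sub_deformation D D' Y Z, nabla_sub D X hN hQ]
  simp only [deformation]
  abel

/-! ### Torsion and the change of curvature -/

section Torsion

variable [FiniteDimensional ℝ E] [CompleteSpace E]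

lemma torsionField_apply (D : CovariantDerivative I E (TangentSpace I : M → Type _))
    {X Y : Π p : M, TangentSpace I p} (hX : IsSmoothField X) (hY : IsSmoothField Y) (p : M) :
    torsionField D X Y p = nabla D X Y p - nabla D Y X p - VectorField.mlieBracket I X Y p :=
  D.torsion_apply (hX.mdifferentiableAt p) (hY.mdifferentiableAt p)

/-- If `∇` is torsion-free, then the torsion of `∇'` is `T(X, Y) = Q(X, Y) - Q(Y, X)`. -/
lemma torsionField_eq_deformation_sub
    {D : CovariantDerivative I E (TangentSpace I : M → Type _)}
    (hD : D.torsion = 0) (D' : CovariantDerivative I E (TangentSpace I : M → Type _))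
    {X Y : Π p : M, TangentSpace I p} (hX : IsSmoothField X) (hY : IsSmoothField Y) :
    torsionField D' X Y = fun p ↦ deformation D D' X Y p - deformation D D' Y X p := by
  funext p
  have h := torsionField_apply D hX hY p
  have h0 : torsionField D X Y p = 0 := by simp [torsionField, hD]
  rw [h0] at h
  have h1 : VectorField.mlieBracket I X Y p = nabla D X Y p - nabla D Y X p :=
    (sub_eq_zero.1 h.symm).symm
  rw [torsionField_apply D' hX hY, h1]
  simp only [deformation]
  abel

/-- Writing T(X, Y) as Q(X, Y) - Q(Y, X) bypasses any smoothness statement for the Lie bracket. -/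
lemma IsSmoothField.torsionField {D D' : CovariantDerivative I E (TangentSpace I : M → Type _)}
    [CovariantDerivative.ContMDiffCovariantDerivative D ∞] (hD : D.torsion = 0)
    [CovariantDerivative.ContMDiffCovariantDerivative D' ∞]
    {X Y : Π p : M, TangentSpace I p} (hX : IsSmoothField X) (hY : IsSmoothField Y) :
    IsSmoothField (AlmostProduct.torsionField D' X Y) := by
  rw [torsionField_eq_deformation_sub hD D' hX hY]
  exact (hX.deformation hY).sub (hY.deformation hX)

/-- Change of the curvature tensor under the transformation `∇ → ∇' = ∇ + Q`. -/
lemma curvature_eq {D D' : CovariantDerivative I E (TangentSpace I : M → Type _)}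
    [CovariantDerivative.ContMDiffCovariantDerivative D ∞]
    [CovariantDerivative.ContMDiffCovariantDerivative D' ∞]
    {X Y Z : Π p : M, TangentSpace I p} (hX : IsSmoothField X) (hY : IsSmoothField Y)
    (hZ : IsSmoothField Z) (p : M) :
    curvature D' X Y Z p = curvature D X Y Z p
      + deformation D D' (torsionField D' X Y) Z p
      + (nabla D' X (deformation D D' Y Z) p - deformation D D' (nabla D' X Y) Z p
        - deformation D D' Y (nabla D' X Z) p)
      - (nabla D' Y (deformation D D' X Z) p - deformation D D' (nabla D' Y X) Z p
        - deformation D D' X (nabla D' Y Z) p)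
      - deformation D D' X (deformation D D' Y Z) p
      + deformation D D' Y (deformation D D' X Z) p := by
  -- The terms Q(∇'_X Y, Z) and Q(∇'_Y X, Z) cancel against those in the derivatives of Q, leaving
  -- -Q([X, Y], Z), the bracket term of R' - R.
  rw [deformation_sub_sub D D' Z (torsionField_apply D' hX hY p)]
  simp only [curvature]
  rw [nabla_nabla_eq (D := D) (D' := D') X hY hZ, nabla_nabla_eq (D := D) (D' := D') Y hX hZ,
    nabla_eq_sub_deformation D D' (VectorField.mlieBracket I X Y) Z]
  dsimp only
  abel

end Torsion

/-! ### Metric connections and parallelism of Q -/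

section Metric

variable [RiemannianBundle (fun p : M ↦ TangentSpace I p)]

/-- The deformation tensor between two metric connections is skew in the last two arguments. -/
lemma inner_deformation_skew {D D' : CovariantDerivative I E (TangentSpace I : M → Type _)}
    (hD : IsMetric D) (hD' : IsMetric D')
    {X Y Z : Π p : M, TangentSpace I p} (hX : IsSmoothField X) (hY : IsSmoothField Y)
    (hZ : IsSmoothField Z) (p : M) :
    (inner ℝ (deformation D D' X Y p) (Z p) : ℝ) = - inner ℝ (deformation D D' X Z p) (Y p) := by
  have h := hD X Y Z hX hY hZ p
  have h' := hD' X Y Z hX hY hZ p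
  simp only [deformation, inner_sub_left]
  rw [real_inner_comm (Y p) (nabla D' X Z p), real_inner_comm (Y p) (nabla D X Z p)]
  linarith

lemma IsSmoothField.mdifferentiableAt_inner
    [IsContMDiffRiemannianBundle I ∞ E (fun p : M ↦ TangentSpace I p)]
    {X Y : Π p : M, TangentSpace I p}
    (hX : IsSmoothField X) (hY : IsSmoothField Y) (p : M) :
    MDifferentiableAt I 𝓘(ℝ) (fun q ↦ (inner ℝ (X q) (Y q) : ℝ)) p :=
  MDifferentiableAt.inner_bundle (hX.mdifferentiableAt p) (hY.mdifferentiableAt p)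

variable [FiniteDimensional ℝ E] [CompleteSpace E]

/-- The deformation tensor of a metric connection is determined by its torsion. -/
lemma two_mul_inner_deformation {D D' : CovariantDerivative I E (TangentSpace I : M → Type _)}
    (hD : IsLeviCivita D) (hD' : IsMetric D')
    {X Y Z : Π p : M, TangentSpace I p} (hX : IsSmoothField X) (hY : IsSmoothField Y)
    (hZ : IsSmoothField Z) (p : M) :
    (2 * inner ℝ (deformation D D' X Y p) (Z p) : ℝ)
      = inner ℝ (torsionField D' X Y p) (Z p) - inner ℝ (torsionField D' Y Z p) (X p)
        + inner ℝ (torsionField D' Z X p) (Y p) := by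
  simp only [torsionField_eq_deformation_sub hD.torsion_free D' hX hY,
    torsionField_eq_deformation_sub hD.torsion_free D' hY hZ,
    torsionField_eq_deformation_sub hD.torsion_free D' hZ hX, inner_sub_left]
  -- One skewness relation per choice of first argument: those led by `Y` and `Z` cancel in pairs,
  -- those led by `X` add up.
  linarith [inner_deformation_skew hD.metric hD' hX hY hZ p,
    inner_deformation_skew hD.metric hD' hY hX hZ p,
    inner_deformation_skew hD.metric hD' hZ hX hY p]

/-- Derivative of `g(T(Y, Z), W)` along `X` for a metric connection with parallel torsion `T`. -/
lemma mvfderiv_inner_torsionField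
    {D D' : CovariantDerivative I E (TangentSpace I : M → Type _)}
    [CovariantDerivative.ContMDiffCovariantDerivative D ∞] (hD : D.torsion = 0)
    [CovariantDerivative.ContMDiffCovariantDerivative D' ∞] (hD' : IsMetric D')
    (hT : HasParallelTorsion D')
    {X Y Z W : Π p : M, TangentSpace I p} (hX : IsSmoothField X) (hY : IsSmoothField Y)
    (hZ : IsSmoothField Z) (hW : IsSmoothField W) (p : M) :
    mvfderiv I (fun q ↦ (inner ℝ (torsionField D' Y Z q) (W q) : ℝ)) p (X p)
      = inner ℝ (torsionField D' (nabla D' X Y) Z p) (W p)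
        + inner ℝ (torsionField D' Y (nabla D' X Z) p) (W p)
        + inner ℝ (torsionField D' Y Z p) (nabla D' X W p) := by
  have hS : IsSmoothField (torsionField D' Y Z) := hY.torsionField hD hZ
  have h := congrFun (hT X Y Z hX hY hZ) p
  have h1 : nabla D' X (torsionField D' Y Z) p
      = torsionField D' (nabla D' X Y) Z p + torsionField D' Y (nabla D' X Z) p := by
    simp only [derivTorsion, Pi.zero_apply, sub_sub] at h
    exact sub_eq_zero.1 h
  rw [hD' X _ W hX hS hW p, h1, inner_add_left]

/-- If a metric connection has parallel torsion, then its deformation tensor is parallel. -/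
lemma inner_nabla_deformation
    [IsContMDiffRiemannianBundle I ∞ E (fun p : M ↦ TangentSpace I p)]
    {D D' : CovariantDerivative I E (TangentSpace I : M → Type _)}
    [CovariantDerivative.ContMDiffCovariantDerivative D ∞] (hD : IsLeviCivita D)
    [CovariantDerivative.ContMDiffCovariantDerivative D' ∞] (hD' : IsMetric D')
    (hT : HasParallelTorsion D')
    {X Y Z W : Π p : M, TangentSpace I p} (hX : IsSmoothField X) (hY : IsSmoothField Y)
    (hZ : IsSmoothField Z) (hW : IsSmoothField W) (p : M) :
    (inner ℝ (nabla D' X (deformation D D' Y Z) p - deformation D D' (nabla D' X Y) Z p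
      - deformation D D' Y (nabla D' X Z) p) (W p) : ℝ) = 0 := by
  have hQ : IsSmoothField (deformation D D' Y Z) := hY.deformation hZ
  have hXY : IsSmoothField (nabla D' X Y) := hX.nabla hY
  have hXZ : IsSmoothField (nabla D' X Z) := hX.nabla hZ
  have hXW : IsSmoothField (nabla D' X W) := hX.nabla hW
  -- The Koszul-type formula as an identity of functions, ready to be differentiated; the factor 2
  -- is a sum, so only additivity of the derivative is needed.
  have hfun : ((fun q ↦ (inner ℝ (deformation D D' Y Z q) (W q) : ℝ))
        + fun q ↦ (inner ℝ (deformation D D' Y Z q) (W q) : ℝ))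
      = ((fun q ↦ (inner ℝ (torsionField D' Y Z q) (W q) : ℝ))
        - fun q ↦ (inner ℝ (torsionField D' Z W q) (Y q) : ℝ))
        + fun q ↦ (inner ℝ (torsionField D' W Y q) (Z q) : ℝ) := by
    funext q
    have := two_mul_inner_deformation hD hD' hY hZ hW q
    simp only [Pi.add_apply, Pi.sub_apply]
    linarith
  have dQ := hQ.mdifferentiableAt_inner hW p
  have d1 := (hY.torsionField hD.torsion_free (D' := D') hZ).mdifferentiableAt_inner hW p
  have d2 := (hZ.torsionField hD.torsion_free (D' := D') hW).mdifferentiableAt_inner hY p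
  have d3 := (hW.torsionField hD.torsion_free (D' := D') hY).mdifferentiableAt_inner hZ p
  have hder := congrArg (fun f : M → ℝ ↦ mvfderiv I f p (X p)) hfun
  simp only [mvfderiv_add dQ dQ, mvfderiv_add (d1.sub d2) d3, mvfderiv_sub d1 d2,
    add_apply, sub_apply] at hder
  rw [mvfderiv_inner_torsionField hD.torsion_free hD' hT hX hY hZ hW,
    mvfderiv_inner_torsionField hD.torsion_free hD' hT hX hZ hW hY,
    mvfderiv_inner_torsionField hD.torsion_free hD' hT hX hW hY hZ,
    hD' X _ W hX hQ hW p] at hder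
  -- The same formula with ∇'_X applied to one slot at a time accounts for all nine torsion terms in
  -- `hder`.
  have k1 := two_mul_inner_deformation hD hD' hXY hZ hW p
  have k2 := two_mul_inner_deformation hD hD' hY hXZ hW p
  have k3 := two_mul_inner_deformation hD hD' hY hZ hXW p
  simp only [inner_sub_left]
  linarith

end Metric

end DeformationCalculus

end AlmostProduct

open AlmostProduct in
theorem lemma6p2
    {E : Type*} [NormedAddCommGroup E] [NormedSpace ℝ E] [FiniteDimensional ℝ E] [CompleteSpace E]
    {H : Type*} [TopologicalSpace H] {I : ModelWithCorners ℝ E H}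
    {M : Type*} [TopologicalSpace M] [T2Space M] [ChartedSpace H M] [IsManifold I ∞ M]
    [RiemannianBundle (fun p : M ↦ TangentSpace I p)]
    [IsContMDiffRiemannianBundle I ∞ E (fun p : M ↦ TangentSpace I p)]
    (P : Π p : M, TangentSpace I p →L[ℝ] TangentSpace I p)
    (hP : IsAlmostProductStructure P)
    -- the Levi-Civita connection `D` of the metric
    (D : CovariantDerivative I E (TangentSpace I : M → Type _))
    [CovariantDerivative.ContMDiffCovariantDerivative D ∞] (hD : IsLeviCivita D)
    -- a natural connection `D'` with parallel torsion
    (D' : CovariantDerivative I E (TangentSpace I : M → Type _))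
    [CovariantDerivative.ContMDiffCovariantDerivative D' ∞] (hD' : IsNaturalConnection P D')
    (hT : HasParallelTorsion D')
    (x y z w : Π p : M, TangentSpace I p)
    (hx : IsSmoothField x) (hy : IsSmoothField y) (hz : IsSmoothField z) (hw : IsSmoothField w)
    (p : M) :
    inner ℝ (curvature D' x y z p) (w p) =
      inner ℝ (curvature D x y z p) (w p)
        + inner ℝ (deformation D D' (torsionField D' x y) z p) (w p)
        + inner ℝ (deformation D D' y z p) (deformation D D' x w p)
        - inner ℝ (deformation D D' x z p) (deformation D D' y w p) := by
  have hxQ : IsSmoothField (deformation D D' x z) := hx.deformation hz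
  have hyQ : IsSmoothField (deformation D D' y z) := hy.deformation hz
  have hm := hD'.metric
  rw [curvature_eq (D := D) (D' := D') hx hy hz p, inner_add_left, inner_sub_left, inner_sub_left,
    inner_add_left, inner_add_left, inner_nabla_deformation hD hm hT hx hy hz hw p,
    inner_nabla_deformation hD hm hT hy hx hz hw p,
    -- Skewness with Q(y,z) in the middle slot: g(Q(x,Q(y,z)),w) = -g(Q(x,w),Q(y,z)).
    inner_deformation_skew hD.metric hm hx hyQ hw p,
    inner_deformation_skew hD.metric hm hy hxQ hw p,
    real_inner_comm (deformation D D' y z p), real_inner_comm (deformation D D' x z p)]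
  ring
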